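/- Let $1\le k\le n$, let $\mathbb{O}^{n\times k}=\{P\in\mathbb{R}^{n\times k}: P^{T}P=I_k\}$, and let $f$ be a real-valued function that is defined and differentiable on a neighborhood $\{P\in\mathbb{R}^{n\times k}:\|P^{T}P-I_k\|_F<\delta\}$ of $\mathbb{O}^{n\times k}$, for some $\delta>0$. Write $\mathscr{H}(P)=\partial f(P)/\partial P\in\mathbb{R}^{n\times k}$ for its Euclidean gradient, with entries $\partial f(P)/\partial p_{ij}$. Let $\mathbb{P}\subseteq\mathbb{O}^{n\times k}$, and assume that $f$ satisfies the NPDo Ansatz on $\mathbb{P}$ with a constant $\omega>0$: whenever $P\in\mathbb{P}$, $\widehat P\in\mathbb{O}^{n\times k}$ and $\eta\in\mathbb{R}$ satisfy $$\operatorname{tr}(\widehat P^{T}\mathscr{H}(P))\ge\operatorname{tr}(P^{T}\mathscr{H}(P))+\eta,$$ there is $Q\in\mathbb{O}^{k\times k}$ such that $\widehat PQ\in\mathbb{P}$ and $f(\widehat PQ)\ge f(P)+\omega\eta$. Let $\{P^{(i)}\}_{i\ge0}$ be generated by the SCF iteration (Algorithm NPDoSCF): $P^{(0)}\in\mathbb{P}$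 and, for $i=0,1,2,\dots$, take a thin SVD $\mathscr{H}(P^{(i)})=U_i\Sigma_iV_i^{T}$, put $\widehat P^{(i)}=U_iV_i^{T}$ (an orthogonal polar factor of $\mathscr{H}(P^{(i)})$), and let $P^{(i+1)}=\widehat P^{(i)}Q_i$, where $Q_i\in\mathbb{O}^{k\times k}$ is a matrix whose existence is stipulated by the Ansatz for $P=P^{(i)}$, $\widehat P=\widehat P^{(i)}$ and $\eta=\eta_i:=\operatorname{tr}([\widehat P^{(i)}]^{T}\mathscr{H}(P^{(i)}))-\operatorname{tr}([P^{(i)}]^{T}\mathscr{H}(P^{(i)}))$, that is, $P^{(i+1)}\in\mathbb{P}$ and $f(P^{(i+1)})\ge f(P^{(i)})+\omega\eta_i$. Then: (a) The sequence $\{f(P^{(i)})\}_{i\ge0}$ is monotonically increasing (i.e. nondecreasing) and convergent. (b) If $\mathscr{H}$ is continuous on $\mathbb{O}^{n\times k}$ (for instance, if $f$ is continuously differentiable), then every accumulation point $P_*$ of $\{P^{(i)}\}$ satisfies the KKT condition $$P_*\in\mathbb{O}^{n\times k},\qquad \mathscr{H}(P_*)=P_*\Lambda_*,\qquad \Lambda_*^{T}=\Lambda_*,\qquad\text{with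 }\Lambda_*=P_*^{T}\mathscr{H}(P_*)\succeq0 .$$ (c) The following two series converge: $$\sum_{i=1}^{\infty}\sigma_{\min}(\mathscr{H}(P^{(i)}))\,\bigl\|\sin\Theta\bigl(\mathcal{R}(P^{(i+1)}),\mathcal{R}(P^{(i)})\bigr)\bigr\|_F^2<\infty,$$ $$\sum_{i=1}^{\infty}\sigma_{\min}(\mathscr{H}(P^{(i)}))\,\frac{\bigl\|\mathscr{H}(P^{(i)})-P^{(i)}\bigl([P^{(i)}]^{T}\mathscr{H}(P^{(i)})\bigr)\bigr\|_F^2}{\|\mathscr{H}(P^{(i)})\|_F^2}<\infty .$$ Here $\sigma_{\min}(B)$ is the smallest of the $k$ singular values of $B\in\mathbb{R}^{n\times k}$, $\mathcal{R}(\cdot)$ is the column space, and, for $X,Y\in\mathbb{O}^{n\times k}$, $\Theta(\mathcal{R}(X),\mathcal{R}(Y))$ is the $k\times k$ diagonal matrix of the canonical angles $\arccos\sigma_j(X^{T}Y)$, $1\le j\le k$. A term of the second series with $\mathscr{H}(P^{(i)})=0$ is read as $0$. -/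

import Mathlib

open Filter Topology

attribute [local instance] Matrix.frobeniusNormedAddCommGroup Matrix.frobeniusNormedSpace

namespace NPDo

noncomputable section

/-- The Stiefel manifold: real `n × k` matrices `P` with `Pᵀ P = I`.
For `n = k` this is the orthogonal group. -/
def stiefel (n k : ℕ) : Set (Matrix (Fin n) (Fin k) ℝ) :=
  {P | P.transpose * P = 1}

/-- The neighborhood `{P | ‖Pᵀ P - I‖ < δ}` of the Stiefel manifold (Frobenius norm). -/
def stiefelNhd (n k : ℕ) (δ : ℝ) : Set (Matrix (Fin n) (Fin k) ℝ) :=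
  {P | ‖P.transpose * P - 1‖ < δ}

/-- The Euclidean gradient `∂f(P)/∂P`: its `(i, j)` entry is the partial derivative of `f` at `P`
with respect to the `(i, j)` entry of `P`. -/
def euclideanGradient {n k : ℕ} (f : Matrix (Fin n) (Fin k) ℝ → ℝ)
    (P : Matrix (Fin n) (Fin k) ℝ) : Matrix (Fin n) (Fin k) ℝ :=
  Matrix.of fun i j => fderiv ℝ f P (Matrix.single i j 1)

/-- The singular values of a real matrix in decreasing order, indexed from `0`. -/
def singularValue {m k : ℕ} (B : Matrix (Fin m) (Fin k) ℝ) (j : ℕ) : ℝ :=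
  (Matrix.toEuclideanLin B).singularValues j

/-- The smallest of the `min m k` singular values of an `m × k` matrix (for `m, k ≥ 1`). -/
def sigmaMin {m k : ℕ} (B : Matrix (Fin m) (Fin k) ℝ) : ℝ :=
  singularValue B (min m k - 1)

/-- For `X`, `Y` with orthonormal columns, the canonical angles between the column spaces of `X`
and `Y`: the `arccos` of the singular values of `Xᵀ Y`. (The order in which the angles are listed
plays no role below.) -/
def canonicalAngle {n k : ℕ} (X Y : Matrix (Fin n) (Fin k) ℝ) (i : Fin k) : ℝ :=
  Real.arccos (singularValue (X.transpose * Y) i)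

/-- The diagonal matrix `sin Θ` of the sines of the canonical angles between the column spaces
of `X` and `Y`, for `X`, `Y` with orthonormal columns. -/
def sinTheta {n k : ℕ} (X Y : Matrix (Fin n) (Fin k) ℝ) : Matrix (Fin k) (Fin k) ℝ :=
  Matrix.diagonal fun i => Real.sin (canonicalAngle X Y i)

/-- `B = U diag(s) Vᵀ` is a thin singular value decomposition of the `n × k` matrix `B`
(meant for `k ≤ n`). -/
structure IsThinSVD {n k : ℕ} (B U : Matrix (Fin n) (Fin k) ℝ) (s : Fin k → ℝ)
    (V : Matrix (Fin k) (Fin k) ℝ) : Prop where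
  left : U ∈ stiefel n k
  right : V ∈ stiefel k k
  nonneg : ∀ j, 0 ≤ s j
  antitone : Antitone s
  eq : B = U * Matrix.diagonal s * V.transpose

/-- The KKT condition `∂f(P)/∂P = P Λ` with `Λ` symmetric and `P` on the Stiefel manifold. -/
def IsKKT {n k : ℕ} (f : Matrix (Fin n) (Fin k) ℝ → ℝ) (P : Matrix (Fin n) (Fin k) ℝ)
    (Lam : Matrix (Fin k) (Fin k) ℝ) : Prop :=
  P ∈ stiefel n k ∧ Lam.transpose = Lam ∧ euclideanGradient f P = P * Lam

/-- What the ansatz requires of `Q`, given `P`, `Phat` and `η`: `Q` is orthogonal, `Phat Q` lies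
in the prescribed set `S`, and `f (Phat Q) ≥ f P + ω η`. -/
def IsAnsatzFactor {n k : ℕ} (f : Matrix (Fin n) (Fin k) ℝ → ℝ)
    (S : Set (Matrix (Fin n) (Fin k) ℝ)) (ω : ℝ) (P Phat : Matrix (Fin n) (Fin k) ℝ) (η : ℝ)
    (Q : Matrix (Fin k) (Fin k) ℝ) : Prop :=
  Q ∈ stiefel k k ∧ Phat * Q ∈ S ∧ f P + ω * η ≤ f (Phat * Q)

/-- The NPDo Ansatz for `f` on the subset `S` of the Stiefel manifold, with constant `ω`. -/
def NPDoAnsatz {n k : ℕ} (f : Matrix (Fin n) (Fin k) ℝ → ℝ)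
    (S : Set (Matrix (Fin n) (Fin k) ℝ)) (ω : ℝ) : Prop :=
  ∀ P ∈ S, ∀ Phat ∈ stiefel n k, ∀ η : ℝ,
    (P.transpose * euclideanGradient f P).trace + η
        ≤ (Phat.transpose * euclideanGradient f P).trace →
      ∃ Q, IsAnsatzFactor f S ω P Phat η Q

/-- One pass `P ↦ Pnext` of the SCF iteration: take a thin SVD of the Euclidean gradient at `P`,
form its orthogonal polar factor `Phat = U Vᵀ`, and put `Pnext = Phat Q` where `Q` is a factor as
in the ansatz for `P`, `Phat` and `η = tr(Phatᵀ ∂f(P)/∂P) - tr(Pᵀ ∂f(P)/∂P)`. -/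
def IsSCFStep {n k : ℕ} (f : Matrix (Fin n) (Fin k) ℝ → ℝ)
    (S : Set (Matrix (Fin n) (Fin k) ℝ)) (ω : ℝ) (P Pnext : Matrix (Fin n) (Fin k) ℝ) : Prop :=
  ∃ (U : Matrix (Fin n) (Fin k) ℝ) (s : Fin k → ℝ) (V Q : Matrix (Fin k) (Fin k) ℝ),
    IsThinSVD (euclideanGradient f P) U s V ∧
    IsAnsatzFactor f S ω P (U * V.transpose)
      (((U * V.transpose).transpose * euclideanGradient f P).trace
        - (P.transpose * euclideanGradient f P).trace) Q ∧
    Pnext = U * V.transpose * Q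

/-- `P` is a sequence generated by the (never stopped) SCF iteration, started in `S`. -/
def IsSCFSequence {n k : ℕ} (f : Matrix (Fin n) (Fin k) ℝ → ℝ)
    (S : Set (Matrix (Fin n) (Fin k) ℝ)) (ω : ℝ) (P : ℕ → Matrix (Fin n) (Fin k) ℝ) : Prop :=
  P 0 ∈ S ∧ ∀ i, IsSCFStep f S ω (P i) (P (i + 1))

end

end NPDo

/-! Everything is controlled by the gain `η`. With `B = H(P) = U diag(s) Vᵀ` and `W = (P V)ᵀ U`, one
has `η = ∑ s j (1 - W j j)`, where `1 - W j j` is half the squared distance between the `j`-th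
columns of `U` and `P V` (`trace_gain_eq`, `one_sub_gram_diag`). Hence `η ≥ 0`, each step raises `f`
by at least `ω η`, and since `f` is bounded on the compact Stiefel manifold, (a) follows and `∑ η`
converges.

For (b), the defect of `B = P M` with `M = V diag(s) Vᵀ ⪰ 0` has squared norm at most `2 ‖B‖ η`
(`norm_sq_sub_le`), so it vanishes in the limit and positive semidefiniteness survives. For (c),
each term is at most `2 η` (`norm_sinTheta_sq_le` with `sigmaMin_mul_sum_le`;
`sigmaMin_mul_residual_le`). -/

namespace NPDo

open Matrix

/-! ### Frobenius norm and matrices with orthonormal columns. -/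

section FrobeniusNorm

variable {m n k : ℕ}

theorem norm_sq_eq_sum (A : Matrix (Fin m) (Fin n) ℝ) : ‖A‖ ^ 2 = ∑ i, ∑ j, A i j ^ 2 := by
  rw [frobenius_norm_def, ← Real.sqrt_eq_rpow, Real.sq_sqrt (by positivity)]
  simp

theorem norm_sq_eq_trace (A : Matrix (Fin m) (Fin n) ℝ) : ‖A‖ ^ 2 = (Aᵀ * A).trace := by
  rw [norm_sq_eq_sum, Finset.sum_comm]
  simp [trace, mul_apply, sq]

theorem norm_stiefel_mul {P : Matrix (Fin n) (Fin k) ℝ} (hP : P ∈ stiefel n k)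
    (A : Matrix (Fin k) (Fin m) ℝ) : ‖P * A‖ = ‖A‖ := by
  have hP' : Pᵀ * P = 1 := hP
  rw [← sq_eq_sq₀ (norm_nonneg _) (norm_nonneg _), norm_sq_eq_trace, norm_sq_eq_trace,
    transpose_mul, Matrix.mul_assoc, ← Matrix.mul_assoc Pᵀ, hP', Matrix.one_mul]

theorem norm_mul_orthogonal {Q : Matrix (Fin k) (Fin k) ℝ} (hQ : Q ∈ stiefel k k)
    (A : Matrix (Fin m) (Fin k) ℝ) : ‖A * Q‖ = ‖A‖ := by
  have hQ' : Q * Qᵀ = 1 := mul_eq_one_comm.mp hQ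
  have hQt : Qᵀ ∈ stiefel k k := by simpa [stiefel] using hQ'
  rw [← frobenius_norm_transpose, transpose_mul, norm_stiefel_mul hQt, frobenius_norm_transpose]

theorem norm_sq_of_mem_stiefel {P : Matrix (Fin n) (Fin k) ℝ} (hP : P ∈ stiefel n k) :
    ‖P‖ ^ 2 = k := by
  have hP' : Pᵀ * P = 1 := hP
  simp [norm_sq_eq_trace, hP']

theorem stiefel_mul {P : Matrix (Fin n) (Fin k) ℝ} {Q : Matrix (Fin k) (Fin m) ℝ}
    (hP : P ∈ stiefel n k) (hQ : Q ∈ stiefel k m) : P * Q ∈ stiefel n m := by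
  have hP' : Pᵀ * P = 1 := hP
  have hQ' : Qᵀ * Q = 1 := hQ
  change (P * Q)ᵀ * (P * Q) = 1
  rw [transpose_mul, Matrix.mul_assoc, ← Matrix.mul_assoc Pᵀ, hP', Matrix.one_mul, hQ']

theorem transpose_mem_stiefel {Q : Matrix (Fin k) (Fin k) ℝ} (hQ : Q ∈ stiefel k k) :
    Qᵀ ∈ stiefel k k := by
  simpa [stiefel] using mul_eq_one_comm.mp hQ

/-- Pythagoras for the orthogonal projection onto the column space of `P`. -/
theorem norm_sq_sub_proj {P : Matrix (Fin n) (Fin k) ℝ} (hP : P ∈ stiefel n k)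
    (X : Matrix (Fin n) (Fin m) ℝ) :
    ‖X - P * (Pᵀ * X)‖ ^ 2 = ‖X‖ ^ 2 - ‖Pᵀ * X‖ ^ 2 := by
  have hP' : Pᵀ * P = 1 := hP
  have h : (X - P * (Pᵀ * X))ᵀ * (X - P * (Pᵀ * X)) = Xᵀ * X - (Pᵀ * X)ᵀ * (Pᵀ * X) := by
    have h1 : Pᵀ * (X - P * (Pᵀ * X)) = 0 := by
      rw [Matrix.mul_sub, ← Matrix.mul_assoc Pᵀ P, hP', Matrix.one_mul, sub_self]
    rw [transpose_sub, transpose_mul P, Matrix.sub_mul, Matrix.mul_assoc, h1, Matrix.mul_zero,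
      sub_zero, Matrix.mul_sub, transpose_mul, transpose_transpose, Matrix.mul_assoc]
  rw [norm_sq_eq_trace, h, trace_sub, ← norm_sq_eq_trace, ← norm_sq_eq_trace]

theorem norm_sub_proj_le {P : Matrix (Fin n) (Fin k) ℝ} (hP : P ∈ stiefel n k)
    (X : Matrix (Fin n) (Fin m) ℝ) : ‖X - P * (Pᵀ * X)‖ ≤ ‖X‖ := by
  have := norm_sq_sub_proj hP X
  exact le_of_sq_le_sq (by nlinarith [sq_nonneg ‖Pᵀ * X‖]) (norm_nonneg _)

theorem norm_transpose_mul_le {P : Matrix (Fin n) (Fin k) ℝ} (hP : P ∈ stiefel n k)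
    (X : Matrix (Fin n) (Fin m) ℝ) : ‖Pᵀ * X‖ ≤ ‖X‖ := by
  have := norm_sq_sub_proj hP X
  exact le_of_sq_le_sq (by nlinarith [sq_nonneg ‖X - P * (Pᵀ * X)‖]) (norm_nonneg _)

end FrobeniusNorm

/-! ### Compactness of the Stiefel manifold; closedness of the semidefinite cone. -/

section Topology

variable {n k : ℕ}

theorem isClosed_stiefel : IsClosed (stiefel n k) := by
  refine isClosed_eq ?_ continuous_const
  fun_prop

theorem isCompact_stiefel : IsCompact (stiefel n k) := by
  have : ProperSpace (Matrix (Fin n) (Fin k) ℝ) := FiniteDimensional.proper ℝ _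
  refine Metric.isCompact_of_isClosed_isBounded isClosed_stiefel ?_
  refine isBounded_iff_forall_norm_le.mpr ⟨√k, fun P hP => ?_⟩
  exact Real.le_sqrt_of_sq_le (norm_sq_of_mem_stiefel hP).le

theorem stiefel_subset_stiefelNhd {δ : ℝ} (hδ : 0 < δ) : stiefel n k ⊆ stiefelNhd n k δ := by
  intro P hP
  have hP' : Pᵀ * P = 1 := hP
  simpa [stiefelNhd, hP'] using hδ

theorem isClosed_posSemidef : IsClosed {A : Matrix (Fin k) (Fin k) ℝ | A.PosSemidef} := by
  have : {A : Matrix (Fin k) (Fin k) ℝ | A.PosSemidef} =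
      {A | Aᵀ = A} ∩ ⋂ x : Fin k → ℝ, {A | 0 ≤ x ⬝ᵥ (A *ᵥ x)} := by
    ext A
    simp [posSemidef_iff_dotProduct_mulVec, IsHermitian]
  rw [this]
  refine (isClosed_eq (by fun_prop) (by fun_prop)).inter (isClosed_iInter fun x => ?_)
  exact isClosed_le continuous_const (by fun_prop)

end Topology

/-! ### Singular values through the Gram operator. -/

section SingularValues

variable {n k : ℕ}

theorem norm_sq_eq_norm_col_sq (x : EuclideanSpace ℝ (Fin k)) :
    ‖x‖ ^ 2 = ‖Matrix.of fun j (_ : Fin 1) => x j‖ ^ 2 := by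
  rw [norm_sq_eq_sum, EuclideanSpace.real_norm_sq_eq]
  simp

theorem norm_toEuclideanLin_sq (B : Matrix (Fin n) (Fin k) ℝ) (x : EuclideanSpace ℝ (Fin k)) :
    ‖toEuclideanLin B x‖ ^ 2 = ‖B * Matrix.of fun j (_ : Fin 1) => x j‖ ^ 2 := by
  rw [norm_sq_eq_sum, EuclideanSpace.real_norm_sq_eq]
  simp [toLpLin_apply, mulVec, dotProduct, mul_apply]

theorem singularValue_nonneg (B : Matrix (Fin n) (Fin k) ℝ) (j : ℕ) : 0 ≤ singularValue B j :=
  LinearMap.singularValues_nonneg _ _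

theorem toEuclideanLin_gram (B : Matrix (Fin n) (Fin k) ℝ) :
    LinearMap.adjoint (toEuclideanLin B) ∘ₗ toEuclideanLin B = toEuclideanLin (Bᵀ * B) := by
  rw [← Matrix.toEuclideanLin_conjTranspose_eq_adjoint, toLpLin_mul 2 2 2]
  rfl

theorem sum_singularValue_sq (B : Matrix (Fin n) (Fin k) ℝ) :
    ∑ j : Fin k, singularValue B j ^ 2 = ‖B‖ ^ 2 := by
  have hn : Module.finrank ℝ (EuclideanSpace ℝ (Fin k)) = k := by simp
  have h := (toEuclideanLin B).isSymmetric_adjoint_comp_self.trace_eq_sum_eigenvalues hn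
  have h' : LinearMap.trace ℝ _ (LinearMap.adjoint (toEuclideanLin B) ∘ₗ toEuclideanLin B) =
      ‖B‖ ^ 2 := by
    rw [toEuclideanLin_gram, toEuclideanLin, toLpLin_eq_toLin, trace_toLin_eq, norm_sq_eq_trace]
  rw [← h', h]
  simp [singularValue, LinearMap.sq_singularValues_fin _ hn]

theorem exists_norm_eq_singularValue (B : Matrix (Fin n) (Fin k) ℝ) (j : Fin k) :
    ∃ x : EuclideanSpace ℝ (Fin k), ‖x‖ = 1 ∧ ‖toEuclideanLin B x‖ = singularValue B j := by
  have hn : Module.finrank ℝ (EuclideanSpace ℝ (Fin k)) = k := by simp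
  set T := toEuclideanLin B
  have hT := T.isSymmetric_adjoint_comp_self
  refine ⟨hT.eigenvectorBasis hn j, by simp, ?_⟩
  rw [← sq_eq_sq₀ (norm_nonneg _) (singularValue_nonneg _ _), singularValue,
    LinearMap.sq_singularValues_fin _ hn, ← real_inner_self_eq_norm_sq,
    ← LinearMap.adjoint_inner_right, ← LinearMap.comp_apply, hT.apply_eigenvectorBasis hn j]
  simp [inner_smul_right]

theorem singularValue_le_one {B : Matrix (Fin n) (Fin k) ℝ}
    (hB : ∀ x, ‖toEuclideanLin B x‖ ≤ ‖x‖) (j : Fin k) : singularValue B j ≤ 1 := by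
  obtain ⟨x, hx, hBx⟩ := exists_norm_eq_singularValue B j
  rw [← hBx, ← hx]
  exact hB x

/-- Expand `x` in an eigenbasis of the Gram operator: every eigenvalue is at least the square of the
last singular value. -/
theorem singularValue_last_mul_norm_le (hk : 1 ≤ k) (B : Matrix (Fin n) (Fin k) ℝ)
    (x : EuclideanSpace ℝ (Fin k)) :
    singularValue B (k - 1) * ‖x‖ ≤ ‖toEuclideanLin B x‖ := by
  have hn : Module.finrank ℝ (EuclideanSpace ℝ (Fin k)) = k := by simp
  set T := toEuclideanLin B with hTdef
  have hT := T.isSymmetric_adjoint_comp_self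
  refine le_of_sq_le_sq ?_ (norm_nonneg _)
  have h1 : ‖T x‖ ^ 2 =
      ∑ i, hT.eigenvalues hn i * inner ℝ (hT.eigenvectorBasis hn i) x ^ 2 := by
    rw [← real_inner_self_eq_norm_sq, ← LinearMap.adjoint_inner_right, ← LinearMap.comp_apply,
      ← OrthonormalBasis.sum_inner_mul_inner (hT.eigenvectorBasis hn)]
    refine Finset.sum_congr rfl fun i _ => ?_
    rw [← hT, hT.apply_eigenvectorBasis hn i, real_inner_comm]
    simp [inner_smul_left]
    ring
  rw [h1, mul_pow, ← (hT.eigenvectorBasis hn).sum_sq_inner_right x, Finset.mul_sum]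
  refine Finset.sum_le_sum fun i _ => mul_le_mul_of_nonneg_right ?_ (sq_nonneg _)
  rw [← LinearMap.sq_singularValues_fin _ hn]
  exact pow_le_pow_left₀ (singularValue_nonneg _ _)
    (T.singularValues_antitone (by omega)) 2

end SingularValues

end NPDo
namespace NPDo

open Matrix

/-! ### One step of the iteration: estimates by the gain. -/

section ThinSVD

variable {n k : ℕ} {B U P : Matrix (Fin n) (Fin k) ℝ} {s : Fin k → ℝ} {V : Matrix (Fin k) (Fin k) ℝ}

theorem one_sub_gram_diag {X Y : Matrix (Fin n) (Fin k) ℝ} (hX : X ∈ stiefel n k)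
    (hY : Y ∈ stiefel n k) (j : Fin k) :
    ∑ i, (X i j - Y i j) ^ 2 = 2 * (1 - (Yᵀ * X) j j) := by
  have hX' : ∑ i, X i j * X i j = 1 := by
    simpa [mul_apply] using congrFun₂ (show Xᵀ * X = 1 from hX) j j
  have hY' : ∑ i, Y i j * Y i j = 1 := by
    simpa [mul_apply] using congrFun₂ (show Yᵀ * Y = 1 from hY) j j
  have h : ∀ i, (X i j - Y i j) ^ 2 = X i j * X i j + Y i j * Y i j - 2 * (Y i j * X i j) := by
    intro i; ring
  simp only [h, Finset.sum_sub_distrib, Finset.sum_add_distrib, ← Finset.mul_sum, hX', hY',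
    mul_apply, transpose_apply]
  ring

theorem gram_diag_le_one {X Y : Matrix (Fin n) (Fin k) ℝ} (hX : X ∈ stiefel n k)
    (hY : Y ∈ stiefel n k) (j : Fin k) : 0 ≤ 1 - (Yᵀ * X) j j := by
  have h := one_sub_gram_diag hX hY j
  have : 0 ≤ ∑ i, (X i j - Y i j) ^ 2 := by positivity
  linarith

namespace IsThinSVD

theorem norm_sq_eq (h : IsThinSVD B U s V) : ‖B‖ ^ 2 = ∑ j, s j ^ 2 := by
  rw [h.eq, norm_mul_orthogonal (transpose_mem_stiefel h.right), norm_stiefel_mul h.left,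
    norm_sq_eq_trace]
  simp [trace_diagonal, sq]

theorem le_norm (h : IsThinSVD B U s V) (j : Fin k) : s j ≤ ‖B‖ := by
  refine le_of_sq_le_sq ?_ (norm_nonneg _)
  rw [h.norm_sq_eq]
  exact Finset.single_le_sum (f := fun j => s j ^ 2) (fun _ _ => sq_nonneg _) (Finset.mem_univ j)

theorem mul_right_eq (h : IsThinSVD B U s V) : B * V = U * diagonal s := by
  have hV : Vᵀ * V = 1 := h.right
  rw [h.eq, Matrix.mul_assoc, hV, Matrix.mul_one]

/-- Testing on the unit vector `V e_j`, which `B` maps to a vector of norm `s j`, avoids identifying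
`s` with the singular values. -/
theorem sigmaMin_le (hk : 1 ≤ k) (hkn : k ≤ n) (h : IsThinSVD B U s V) (j : Fin k) :
    sigmaMin B ≤ s j := by
  have hcol : ∀ {l : ℕ} (A : Matrix (Fin l) (Fin k) ℝ),
      (A * Matrix.of fun i (_ : Fin 1) => V i j) = Matrix.of fun i (_ : Fin 1) => (A * V) i j := by
    intro l A
    ext a b
    simp [mul_apply]
  let x : EuclideanSpace ℝ (Fin k) := WithLp.toLp 2 fun i => V i j
  have hx : ‖x‖ = 1 := by
    rw [← sq_eq_sq₀ (norm_nonneg _) zero_le_one, EuclideanSpace.real_norm_sq_eq]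
    simpa [mul_apply, x, sq] using congrFun₂ (show Vᵀ * V = 1 from h.right) j j
  have hBx : ‖toEuclideanLin B x‖ = s j := by
    rw [← sq_eq_sq₀ (norm_nonneg _) (h.nonneg j), norm_toEuclideanLin_sq]
    simp only [x]
    rw [hcol, h.mul_right_eq, norm_sq_eq_sum]
    simp only [Finset.univ_unique, Finset.sum_singleton, of_apply, mul_diagonal, mul_pow,
      ← Finset.sum_mul]
    have : ∑ i, U i j ^ 2 = 1 := by
      simpa [mul_apply, sq] using congrFun₂ (show Uᵀ * U = 1 from h.left) j j
    rw [this, one_mul]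
  have := singularValue_last_mul_norm_le hk B x
  rw [hx, mul_one, hBx] at this
  rwa [sigmaMin, Nat.min_eq_right hkn]

/-- The gain `η` of the polar factor, in terms of the deviation of `P V` from `U`. -/
theorem trace_gain_eq (h : IsThinSVD B U s V) (P : Matrix (Fin n) (Fin k) ℝ) :
    ((U * Vᵀ)ᵀ * B).trace - (Pᵀ * B).trace = ∑ j, s j * (1 - ((P * V)ᵀ * U) j j) := by
  have hU : Uᵀ * U = 1 := h.left
  have hV : Vᵀ * V = 1 := h.right
  have key : ∀ X : Matrix (Fin n) (Fin k) ℝ,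
      (Xᵀ * B).trace = ∑ j, s j * ((X * V)ᵀ * U) j j := by
    intro X
    rw [h.eq, ← Matrix.mul_assoc, trace_mul_comm, ← Matrix.mul_assoc, ← Matrix.mul_assoc,
      ← transpose_mul]
    simp [trace, mul_diagonal, mul_comm]
  rw [key, key, ← Finset.sum_sub_distrib]
  refine Finset.sum_congr rfl fun j _ => ?_
  rw [Matrix.mul_assoc U, hV, Matrix.mul_one, hU, one_apply_eq]
  ring

theorem trace_gain_nonneg (h : IsThinSVD B U s V) (hP : P ∈ stiefel n k) :
    0 ≤ ((U * Vᵀ)ᵀ * B).trace - (Pᵀ * B).trace := by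
  rw [h.trace_gain_eq]
  exact Finset.sum_nonneg fun j _ =>
    mul_nonneg (h.nonneg j) (gram_diag_le_one h.left (stiefel_mul hP h.right) j)

/-- The defect is `(U - P V) diag(s) Vᵀ`. Of the resulting weights `s j ^ 2`, one factor is bounded
by `‖B‖` and the other is kept for the gain. -/
theorem norm_sq_sub_le (h : IsThinSVD B U s V) (hP : P ∈ stiefel n k) :
    ‖B - P * (V * diagonal s * Vᵀ)‖ ^ 2 ≤
      2 * ‖B‖ * (((U * Vᵀ)ᵀ * B).trace - (Pᵀ * B).trace) := by
  have h1 : B - P * (V * diagonal s * Vᵀ) = (U - P * V) * diagonal s * Vᵀ := by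
    rw [h.eq, Matrix.sub_mul, Matrix.sub_mul]
    simp only [Matrix.mul_assoc]
  rw [h1, norm_mul_orthogonal (transpose_mem_stiefel h.right), norm_sq_eq_sum, Finset.sum_comm,
    h.trace_gain_eq, Finset.mul_sum]
  refine Finset.sum_le_sum fun j _ => ?_
  simp only [mul_diagonal, mul_pow, Matrix.sub_apply, ← Finset.sum_mul]
  rw [one_sub_gram_diag h.left (stiefel_mul hP h.right)]
  have hd := mul_nonneg (gram_diag_le_one h.left (stiefel_mul hP h.right) j) (h.nonneg j)
  nlinarith [mul_le_mul_of_nonneg_left (h.le_norm j) hd]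

theorem sigmaMin_mul_sum_le (hk : 1 ≤ k) (hkn : k ≤ n) (h : IsThinSVD B U s V)
    (hP : P ∈ stiefel n k) :
    sigmaMin B * ∑ j, (1 - ((P * V)ᵀ * U) j j) ≤ ((U * Vᵀ)ᵀ * B).trace - (Pᵀ * B).trace := by
  rw [h.trace_gain_eq, Finset.mul_sum]
  exact Finset.sum_le_sum fun j _ => mul_le_mul_of_nonneg_right (h.sigmaMin_le hk hkn j)
    (gram_diag_le_one h.left (stiefel_mul hP h.right) j)

theorem sigmaMin_mul_residual_le (hk : 1 ≤ k) (hkn : k ≤ n) (h : IsThinSVD B U s V)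
    (hP : P ∈ stiefel n k) :
    sigmaMin B * (‖B - P * (Pᵀ * B)‖ ^ 2 / ‖B‖ ^ 2) ≤
      2 * (((U * Vᵀ)ᵀ * B).trace - (Pᵀ * B).trace) := by
  have hη := h.trace_gain_nonneg hP
  set η := ((U * Vᵀ)ᵀ * B).trace - (Pᵀ * B).trace
  set M := V * diagonal s * Vᵀ
  have hP' : Pᵀ * P = 1 := hP
  have hres : ‖B - P * (Pᵀ * B)‖ ^ 2 ≤ 2 * ‖B‖ * η := by
    refine le_trans (pow_le_pow_left₀ (norm_nonneg _) ?_ 2) (h.norm_sq_sub_le hP)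
    -- Projecting away the columns of `P` kills `P * M`, so the residual of `B` is that of `B - P *
    -- M`.
    have := norm_sub_proj_le hP (B - P * M)
    rwa [Matrix.mul_sub Pᵀ, ← Matrix.mul_assoc Pᵀ P, hP', Matrix.one_mul, Matrix.mul_sub P,
      sub_sub_sub_cancel_right] at this
  have hσ : sigmaMin B ≤ ‖B‖ := (h.sigmaMin_le hk hkn ⟨0, hk⟩).trans (h.le_norm _)
  rcases (norm_nonneg B).eq_or_lt with h0 | h0
  -- For `B = 0` the quotient is `0 / 0 = 0`.
  · simpa [← h0] using hη
  · rw [← mul_div_assoc, div_le_iff₀ (by positivity)]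
    calc sigmaMin B * ‖B - P * (Pᵀ * B)‖ ^ 2 ≤ ‖B‖ * (2 * ‖B‖ * η) :=
          mul_le_mul hσ hres (sq_nonneg _) h0.le
      _ = 2 * η * ‖B‖ ^ 2 := by ring

end IsThinSVD

theorem norm_sinTheta_sq {X Y : Matrix (Fin n) (Fin k) ℝ} (hX : X ∈ stiefel n k)
    (hY : Y ∈ stiefel n k) : ‖sinTheta X Y‖ ^ 2 = k - ‖Xᵀ * Y‖ ^ 2 := by
  have hc : ∀ x, ‖toEuclideanLin (Xᵀ * Y) x‖ ≤ ‖x‖ := by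
    intro x
    refine le_of_sq_le_sq ?_ (norm_nonneg _)
    rw [norm_sq_eq_norm_col_sq x, norm_toEuclideanLin_sq, Matrix.mul_assoc,
      ← norm_stiefel_mul hY (Matrix.of fun j (_ : Fin 1) => x j)]
    exact pow_le_pow_left₀ (norm_nonneg _) (norm_transpose_mul_le hX _) 2
  have hs : ∀ j : Fin k, Real.sin (canonicalAngle X Y j) ^ 2 =
      1 - singularValue (Xᵀ * Y) j ^ 2 := by
    intro j
    have h0 := singularValue_nonneg (Xᵀ * Y) j
    have h1 := singularValue_le_one hc j
    rw [canonicalAngle, Real.sin_arccos, Real.sq_sqrt (by nlinarith)]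
  rw [sinTheta, norm_sq_eq_trace, diagonal_transpose, diagonal_mul_diagonal, trace_diagonal,
    ← sum_singularValue_sq]
  simp_rw [← sq, hs]
  simp

/-- Orthogonal factors do not affect the norm of the cosine matrix, so `Q` drops out and `W = (P V)ᵀ
U` remains. Discard its off-diagonal entries and use `1 - w ^ 2 ≤ 2 (1 - w)`. -/
theorem norm_sinTheta_sq_le (hU : U ∈ stiefel n k) (hP : P ∈ stiefel n k) (hV : V ∈ stiefel k k)
    {Q : Matrix (Fin k) (Fin k) ℝ} (hQ : Q ∈ stiefel k k) :
    ‖sinTheta (U * Vᵀ * Q) P‖ ^ 2 ≤ 2 * ∑ j, (1 - ((P * V)ᵀ * U) j j) := by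
  have hUV := stiefel_mul hU (transpose_mem_stiefel hV)
  rw [norm_sinTheta_sq (stiefel_mul hUV hQ) hP]
  have h1 : ‖(U * Vᵀ * Q)ᵀ * P‖ = ‖(P * V)ᵀ * U‖ := by
    have hT : ((P * V)ᵀ * U)ᵀ = Uᵀ * P * V := by
      rw [transpose_mul, transpose_transpose, Matrix.mul_assoc]
    rw [transpose_mul, Matrix.mul_assoc, norm_stiefel_mul (transpose_mem_stiefel hQ),
      transpose_mul, transpose_transpose, Matrix.mul_assoc, norm_stiefel_mul hV,
      ← frobenius_norm_transpose ((P * V)ᵀ * U), hT, norm_mul_orthogonal hV]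
  rw [h1]
  set W := (P * V)ᵀ * U
  have h2 : ∑ j, W j j ^ 2 ≤ ‖W‖ ^ 2 := by
    rw [norm_sq_eq_sum]
    exact Finset.sum_le_sum fun j _ => Finset.single_le_sum (f := fun i => W j i ^ 2)
      (fun _ _ => sq_nonneg _) (Finset.mem_univ j)
  have h3 : ∑ j, (1 - W j j ^ 2) ≤ 2 * ∑ j, (1 - W j j) := by
    rw [Finset.mul_sum]
    exact Finset.sum_le_sum fun j _ => by nlinarith [sq_nonneg (1 - W j j)]
  rw [Finset.sum_sub_distrib] at h3
  simp only [Finset.sum_const, Finset.card_univ, Fintype.card_fin, nsmul_eq_mul, mul_one] at h3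
  linarith

end ThinSVD

/-! ### Passage to the limit. -/

section Convergence

variable {n k : ℕ}

theorem IsThinSVD.posSemidef {B U : Matrix (Fin n) (Fin k) ℝ} {s : Fin k → ℝ}
    {V : Matrix (Fin k) (Fin k) ℝ} (h : IsThinSVD B U s V) :
    (V * diagonal s * Vᵀ).PosSemidef := by
  simpa using (PosSemidef.diagonal h.nonneg).mul_mul_conjTranspose_same V

/-- A limit of polar-type factorizations `B ≈ P M` with `M ⪰ 0` is exact. -/
theorem eq_mul_posSemidef_of_tendsto {ι : Type*} {l : Filter ι} [l.NeBot]
    {P B : ι → Matrix (Fin n) (Fin k) ℝ} {M : ι → Matrix (Fin k) (Fin k) ℝ}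
    {P' B' : Matrix (Fin n) (Fin k) ℝ} (hP : ∀ i, P i ∈ stiefel n k)
    (hM : ∀ i, (M i).PosSemidef) (hPl : Tendsto P l (𝓝 P')) (hBl : Tendsto B l (𝓝 B'))
    (h : Tendsto (fun i => ‖B i - P i * M i‖) l (𝓝 0)) :
    B' = P' * (P'ᵀ * B') ∧ (P'ᵀ * B').PosSemidef := by
  have hX : Tendsto (fun i => B i - P i * M i) l (𝓝 0) := tendsto_zero_iff_norm_tendsto_zero.mpr h
  have hPt : Tendsto (fun i => (P i)ᵀ) l (𝓝 P'ᵀ) :=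
    (continuous_id.matrix_transpose.tendsto P').comp hPl
  have hmul : ∀ {a b c : ℕ} {F : ι → Matrix (Fin a) (Fin b) ℝ} {G : ι → Matrix (Fin b) (Fin c) ℝ}
      {F' G'}, Tendsto F l (𝓝 F') → Tendsto G l (𝓝 G') →
      Tendsto (fun i => F i * G i) l (𝓝 (F' * G')) := by
    intro a b c F G F' G' hF hG
    exact ((continuous_fst.matrix_mul continuous_snd).tendsto (F', G')).comp (hF.prodMk_nhds hG)
  -- Convergence of `M` is not assumed: it comes from `M = Pᵀ B - Pᵀ (B - P M)`.
  have hMl : Tendsto M l (𝓝 (P'ᵀ * B')) := by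
    have h1 := (hmul hPt hBl).sub (hmul hPt hX)
    rw [Matrix.mul_zero, sub_zero] at h1
    refine h1.congr fun i => ?_
    rw [Matrix.mul_sub, ← Matrix.mul_assoc, show (P i)ᵀ * P i = 1 from hP i, Matrix.one_mul,
      sub_sub_cancel]
  refine ⟨?_, isClosed_posSemidef.mem_of_tendsto hMl (Eventually.of_forall hM)⟩
  have h1 := (hX.add (hmul hPl hMl)).congr fun i => sub_add_cancel (B i) (P i * M i)
  rw [zero_add] at h1
  exact tendsto_nhds_unique hBl h1

theorem monotone_of_add_le {a η : ℕ → ℝ} (hη : ∀ i, 0 ≤ η i) (h : ∀ i, a i + η i ≤ a (i + 1)) :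
    Monotone a :=
  monotone_nat_of_le_succ fun i => by linarith [hη i, h i]

theorem summable_of_add_le {a η : ℕ → ℝ} {C : ℝ} (hη : ∀ i, 0 ≤ η i)
    (h : ∀ i, a i + η i ≤ a (i + 1)) (hC : ∀ i, a i ≤ C) : Summable η := by
  refine summable_of_sum_range_le (c := C - a 0) hη fun N => ?_
  have : ∑ i ∈ Finset.range N, η i ≤ ∑ i ∈ Finset.range N, (a (i + 1) - a i) :=
    Finset.sum_le_sum fun i _ => by linarith [h i]
  rw [Finset.sum_range_sub] at this
  linarith [hC N]

end Convergence

end NPDo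

theorem mainTheorem1 (n k : ℕ) (hk : 1 ≤ k) (hkn : k ≤ n)
    (f : Matrix (Fin n) (Fin k) ℝ → ℝ) (δ : ℝ) (hδ : 0 < δ)
    (hf : DifferentiableOn ℝ f (NPDo.stiefelNhd n k δ))
    (S : Set (Matrix (Fin n) (Fin k) ℝ)) (hS : S ⊆ NPDo.stiefel n k)
    (ω : ℝ) (hω : 0 < ω) (hAnsatz : NPDo.NPDoAnsatz f S ω)
    (P : ℕ → Matrix (Fin n) (Fin k) ℝ) (hP : NPDo.IsSCFSequence f S ω P) :
    -- (a) monotone convergence of the objective values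
    (Monotone (fun i => f (P i)) ∧ ∃ L : ℝ, Tendsto (fun i => f (P i)) atTop (𝓝 L)) ∧
    -- (b) accumulation points, if the gradient is continuous on the Stiefel manifold
    (ContinuousOn (NPDo.euclideanGradient f) (NPDo.stiefel n k) →
      ∀ Pstar : Matrix (Fin n) (Fin k) ℝ, MapClusterPt Pstar atTop P →
        NPDo.IsKKT f Pstar (Pstar.transpose * NPDo.euclideanGradient f Pstar) ∧
        (Pstar.transpose * NPDo.euclideanGradient f Pstar).PosSemidef) ∧
    -- (c) the two convergent series, summed over the indices `i + 1 = 1, 2, 3, …`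
    Summable (fun i : ℕ =>
      NPDo.sigmaMin (NPDo.euclideanGradient f (P (i + 1))) *
        ‖NPDo.sinTheta (P (i + 2)) (P (i + 1))‖ ^ 2) ∧
    Summable (fun i : ℕ =>
      NPDo.sigmaMin (NPDo.euclideanGradient f (P (i + 1))) *
        (‖NPDo.euclideanGradient f (P (i + 1)) -
            P (i + 1) * ((P (i + 1)).transpose * NPDo.euclideanGradient f (P (i + 1)))‖ ^ 2 /
          ‖NPDo.euclideanGradient f (P (i + 1))‖ ^ 2)) := by

  choose hP0 U s V Q hSVD hQ hnext using hP
  have hPS : ∀ i, P i ∈ NPDo.stiefel n k := by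
    intro i
    cases i with
    | zero => exact hS hP0
    | succ i => exact hS (hnext i ▸ (hQ i).2.1)
  set H := NPDo.euclideanGradient f with hH
  let η : ℕ → ℝ := fun i =>
    ((U i * (V i).transpose).transpose * H (P i)).trace - ((P i).transpose * H (P i)).trace
  have hη : ∀ i, 0 ≤ η i := fun i => (hSVD i).trace_gain_nonneg (hPS i)
  have hωη : ∀ i, 0 ≤ ω * η i := fun i => mul_nonneg hω.le (hη i)
  have hstep : ∀ i, f (P i) + ω * η i ≤ f (P (i + 1)) := by
    intro i
    rw [hnext i]
    exact (hQ i).2.2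
  -- Differentiability of `f` serves only to give continuity, hence an upper bound on a compact set.
  obtain ⟨C, hC⟩ := NPDo.isCompact_stiefel.bddAbove_image
    (hf.continuousOn.mono (NPDo.stiefel_subset_stiefelNhd hδ))
  have hfC : ∀ i, f (P i) ≤ C := fun i => hC (Set.mem_image_of_mem f (hPS i))
  have hmono : Monotone fun i => f (P i) := NPDo.monotone_of_add_le hωη hstep
  have hsum : Summable η :=
    (summable_mul_left_iff hω.ne').mp (NPDo.summable_of_add_le hωη hstep hfC)
  have hσ : ∀ i, 0 ≤ NPDo.sigmaMin (H (P i)) := fun i => NPDo.singularValue_nonneg _ _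
  have hsum2 : Summable fun i => 2 * η (i + 1) := ((summable_nat_add_iff 1).mpr hsum).mul_left 2
  refine ⟨⟨hmono, _, tendsto_atTop_ciSup hmono ⟨C, Set.forall_mem_range.mpr hfC⟩⟩, ?_, ?_, ?_⟩
  · intro hcont Pstar hcl
    -- An ultrafilter finer than `atTop` plays the role of a convergent subsequence.
    obtain ⟨l, hl, hPl⟩ := mapClusterPt_iff_ultrafilter.mp hcl
    have hstar : Pstar ∈ NPDo.stiefel n k :=
      NPDo.isClosed_stiefel.mem_of_tendsto hPl (Eventually.of_forall hPS)
    have hHl : Tendsto (fun i => H (P i)) l (𝓝 (H Pstar)) :=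
      (hcont Pstar hstar).tendsto.comp
        (tendsto_nhdsWithin_iff.mpr ⟨hPl, Eventually.of_forall hPS⟩)
    have hη0 : Tendsto η l (𝓝 0) := hsum.tendsto_atTop_zero.mono_left hl
    have hbound : Tendsto (fun i => √(2 * ‖H (P i)‖ * η i)) l (𝓝 0) := by
      have := ((hHl.norm.const_mul 2).mul hη0).sqrt
      rwa [mul_zero, Real.sqrt_zero] at this
    obtain ⟨h1, h2⟩ := NPDo.eq_mul_posSemidef_of_tendsto hPS (fun i => (hSVD i).posSemidef) hPl hHl
      (squeeze_zero (fun _ => norm_nonneg _)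
        (fun i => Real.le_sqrt_of_sq_le ((hSVD i).norm_sq_sub_le (hPS i))) hbound)
    exact ⟨⟨hstar, by simpa using h2.isHermitian.eq, h1⟩, h2⟩
  · refine hsum2.of_nonneg_of_le (fun i => mul_nonneg (hσ _) (sq_nonneg _)) fun i => ?_
    rw [hnext (i + 1)]
    have h1 := NPDo.norm_sinTheta_sq_le (hSVD (i + 1)).left (hPS (i + 1)) (hSVD (i + 1)).right
      (hQ (i + 1)).1
    have h2 := (hSVD (i + 1)).sigmaMin_mul_sum_le hk hkn (hPS (i + 1))
    exact (mul_le_mul_of_nonneg_left h1 (hσ _)).trans (by linarith)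
  · exact hsum2.of_nonneg_of_le
      (fun i => mul_nonneg (hσ _) (div_nonneg (sq_nonneg _) (sq_nonneg _)))
      fun i => (hSVD (i + 1)).sigmaMin_mul_residual_le hk hkn (hPS (i + 1))
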